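/- Let $\mathcal{C}$ be a variety of (finitary) universal algebras, given by a set of operation symbols and a set of identities; the empty algebra is allowed when there are no constants. Let $U$ be the underlying-set functor, $F(X)$ the free algebra of $\mathcal{C}$ on a set $X$, and $F(\emptyset)$ the initial algebra, whose elements are the constant terms; a constant $\omega\in F(\emptyset)$ has a value, again written $\omega$, in every algebra. Let $+$ denote the coproduct in $\mathcal{C}$, $F(\emptyset)^2=F(\emptyset)\times F(\emptyset)$, and write $x\in A$ and $(\omega,\omega')\in F(\emptyset)^2$ also for their images in $A+F(\emptyset)^2$. A category with finite products is coextensive if for all objects $X,Y$ the canonical functor $\times\colon X/\mathcal{C}\times Y/\mathcal{C}\to (X\times Y)/\mathcal{C}$ is an equivalence. A diagonalizing term of $\mathcal{C}$ is a $(k+2)$-ary term $t$, for some $k\ge 1$, together with constants $e_1,\dots,e_k,e_1',\dots,e_k'\in F(\emptyset)$ such that $\mathcal{C}$ satisfies the identities $$t(x,y,e_1,\dots,e_k)=x,\qquad t(x,y,e_1',\dots,e_k')=y.$$ Given such a term, define $\delta(x,y)=t(x,y,(e_1,e_1'),\dots,(e_k,e_k'))$ for $x,y\in A+F(\emptyset)^2$.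 The following statements are equivalent: (1) $\mathcal{C}$ is coextensive. (2) $\mathcal{C}$ has a diagonalizing term, and for every algebra $A\in\mathcal{C}$, all $m,n\ge 0$, all $(m+n)$-ary terms $u,v$, all $a_1,\dots,a_m\in U(A)$ (regarded as variables, i.e. free generators, in $FU(A)$) and all constants $\omega_1,\dots,\omega_n,\omega_1',\dots,\omega_n'\in F(\emptyset)$: if $$u(a_1,\dots,a_m,\omega_1,\dots,\omega_n)=v(a_1,\dots,a_m,\omega_1,\dots,\omega_n),\quad u(a_1,\dots,a_m,\omega_1',\dots,\omega_n')=v(a_1,\dots,a_m,\omega_1',\dots,\omega_n')$$ hold in $FU(A)$, then $$u(a_1,\dots,a_m,(\omega_1,\omega_1'),\dots,(\omega_n,\omega_n'))=v(a_1,\dots,a_m,(\omega_1,\omega_1'),\dots,(\omega_n,\omega_n'))$$ holds in $FU(A)+F(\emptyset)^2$. (3) $\mathcal{C}$ has a diagonalizing term such that for every set $X$: (a) $\delta(x,x)=x$ for every $x\in F(X)+F(\emptyset)^2$; (b) $u(\delta(x_1,y_1),\dots,\delta(x_n,y_n))=\delta(u(x_1,\dots,x_n),u(y_1,\dots,y_n))$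 for every $n\ge 0$, every $n$-ary term $u$ and all $x_i,y_i\in F(X)+F(\emptyset)^2$. -/

import Mathlib

open CategoryTheory FirstOrder FirstOrder.Language

universe u v

/-! ### Coextensive categories -/

/-- The canonical functor `X/C × Y/C ⥤ (X × Y)/C`, `(f, g) ↦ f × g`. -/
noncomputable def underProd {C : Type*} [Category C] [Limits.HasFiniteProducts C] (X Y : C) :
    Under X × Under Y ⥤ Under (Limits.prod X Y) where
  obj P := Under.mk (Limits.prod.map P.1.hom P.2.hom)
  map {P Q} φ := Under.homMk (Limits.prod.map φ.1.right φ.2.right) (by simp)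

/-- `C` has finite products and every canonical functor `X/C × Y/C ⥤ (X × Y)/C` is an
equivalence. -/
def IsCoextensive (C : Type*) [Category C] : Prop :=
  ∃ _ : Limits.HasFiniteProducts C, ∀ X Y : C, (underProd X Y).IsEquivalence

/-! ### Varieties of universal algebras -/

/-- An algebra of the variety with operation symbols the function symbols of `L` and with the
set of identities `E` (pairs of terms in the variables `x₀, x₁, …`). The carrier may be empty. -/
structure VarietyAlg (L : FirstOrder.Language.{u, v}) (E : Set (L.Term ℕ × L.Term ℕ)) where
  /-- The underlying set. -/
  carrier : Type u
  /-- The operations. -/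
  [str : L.Structure carrier]
  /-- The identities hold. -/
  sat : ∀ p ∈ E, ∀ x : ℕ → carrier, p.1.realize x = p.2.realize x

namespace VarietyAlg

variable {L : FirstOrder.Language.{u, v}} {E : Set (L.Term ℕ × L.Term ℕ)}

instance : CoeSort (VarietyAlg L E) (Type u) := ⟨carrier⟩

instance (A : VarietyAlg L E) : L.Structure A := A.str

/-- The category of algebras of the variety, with all homomorphisms. -/
instance : Category (VarietyAlg L E) where
  Hom A B := A →[L] B
  id A := Hom.id L A
  comp f g := Hom.comp g f

/-- The product of two algebras, on the cartesian product of the underlying sets. -/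
def prod (A B : VarietyAlg L E) : VarietyAlg L E where
  carrier := A × B
  str :=
    { funMap := fun f x => (Structure.funMap f fun i => (x i).1, Structure.funMap f fun i => (x i).2)
      RelMap := fun r x => Structure.RelMap r (fun i => (x i).1) ∧
        Structure.RelMap r (fun i => (x i).2) }
  sat p hp x := by
    let : L.Structure (A × B) :=
      { funMap := fun f x =>
          (Structure.funMap f fun i => (x i).1, Structure.funMap f fun i => (x i).2)
        RelMap := fun r x => Structure.RelMap r (fun i => (x i).1) ∧
          Structure.RelMap r (fun i => (x i).2) }
    have key : ∀ t : L.Term ℕ, t.realize x =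
        (t.realize (fun i => (x i).1), t.realize (fun i => (x i).2)) := by
      intro t
      induction t with
      | var => rfl
      | func f ts ih =>
        simp only [Term.realize_func, ih]
        rfl
    exact (key p.1).trans ((Prod.ext (A.sat p hp _) (B.sat p hp _)).trans (key p.2).symm)

/-- The congruence on terms in the generators `G` that is generated by the relations `R` and all
substitution instances of the identities `E`. -/
inductive PresRel (E : Set (L.Term ℕ × L.Term ℕ)) {G : Type u} (R : L.Term G → L.Term G → Prop) :
    L.Term G → L.Term G → Prop
  | rel {s t} : R s t → PresRel E R s t
  | identity {p} (hp : p ∈ E) (σ : ℕ → L.Term G) : PresRel E R (p.1.subst σ) (p.2.subst σ)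
  | refl (s) : PresRel E R s s
  | symm {s t} : PresRel E R s t → PresRel E R t s
  | trans {s t r} : PresRel E R s t → PresRel E R t r → PresRel E R s r
  | congr {n : ℕ} (f : L.Functions n) (x y : Fin n → L.Term G) :
      (∀ i, PresRel E R (x i) (y i)) → PresRel E R (Term.func f x) (Term.func f y)

/-- The congruence `PresRel` as a setoid. -/
def presSetoid (E : Set (L.Term ℕ × L.Term ℕ)) {G : Type u} (R : L.Term G → L.Term G → Prop) :
    Setoid (L.Term G) where
  r := PresRel E R
  iseqv := ⟨PresRel.refl, PresRel.symm, PresRel.trans⟩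

variable [L.IsAlgebraic]

/-- The terms in `G`, with the operations compatible with `PresRel`. -/
instance presPrestructure {G : Type u} (R : L.Term G → L.Term G → Prop) :
    L.Prestructure (presSetoid E R) where
  toStructure :=
    { funMap := fun f x => Term.func f x
      RelMap := fun r => isEmptyElim r }
  fun_equiv {_ f} x y h := PresRel.congr f x y h
  rel_equiv {_ r} := isEmptyElim r

/-- Evaluating a term at classes of terms is the class of the substituted term. -/
theorem realize_pres {G : Type u} (R : L.Term G → L.Term G → Prop) {α : Type*} (t : L.Term α)
    (σ : α → L.Term G) :
    t.realize (fun i => (Quotient.mk (presSetoid E R) (σ i))) =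
      Quotient.mk (presSetoid E R) (t.subst σ) := by
  induction t with
  | var => rfl
  | func f ts ih =>
    simp only [Term.realize_func, ih]
    exact funMap_quotient_mk' (presSetoid E R) f _

/-- The algebra of the variety presented by generators `G` and relations `R`. -/
def pres (E : Set (L.Term ℕ × L.Term ℕ)) {G : Type u} (R : L.Term G → L.Term G → Prop) :
    VarietyAlg L E where
  carrier := Quotient (presSetoid E R)
  sat p hp x := by
    obtain ⟨σ, rfl⟩ : ∃ σ : ℕ → L.Term G, x = fun i => Quotient.mk (presSetoid E R) (σ i) :=
      ⟨fun i => (x i).out, funext fun i => (Quotient.out_eq _).symm⟩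
    rw [realize_pres, realize_pres]
    exact Quotient.sound (PresRel.identity hp σ)

/-- The image of a generator in the presented algebra. -/
def gen {G : Type u} (R : L.Term G → L.Term G → Prop) (g : G) : pres E R :=
  Quotient.mk (presSetoid E R) (Term.var g)

/-- The homomorphism out of a presented algebra given by values of the generators that satisfy
the relations. -/
def presLift {G : Type u} {R : L.Term G → L.Term G → Prop} {A : VarietyAlg L E} (φ : G → A)
    (h : ∀ s t, R s t → s.realize φ = t.realize φ) : pres E R ⟶ A :=
  show pres E R →[L] A from
  { toFun := Quotient.lift (fun t => t.realize φ) (by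
      intro s t hst
      induction (show PresRel E R s t from hst) with
      | rel hr => exact h _ _ hr
      | identity hp σ => simpa only [Term.realize_subst] using A.sat _ hp _
      | refl => rfl
      | symm h ih => exact (ih h).symm
      | trans h1 h2 ih1 ih2 => exact (ih1 h1).trans (ih2 h2)
      | congr f x y hxy ih =>
        simp only [Term.realize_func]
        exact congrArg _ (funext fun i => ih i (hxy i)))
    map_fun' := by
      intro n f x
      obtain ⟨σ, rfl⟩ : ∃ σ : Fin n → L.Term G, x = fun i => Quotient.mk (presSetoid E R) (σ i) :=
        ⟨fun i => (x i).out, funext fun i => (Quotient.out_eq _).symm⟩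
      exact congrArg (Quotient.lift (fun t : L.Term G => t.realize φ) _)
        (funMap_quotient_mk' (presSetoid E R) f σ)
    map_rel' := fun r => isEmptyElim r }

/-- The free algebra `F(X)` of the variety on the set `X`. -/
def free (E : Set (L.Term ℕ × L.Term ℕ)) (X : Type u) : VarietyAlg L E :=
  pres E (G := X) fun _ _ => False

/-- The variable `x ∈ X` as an element of `F(X)`. -/
def freeVar (E : Set (L.Term ℕ × L.Term ℕ)) {X : Type u} (x : X) : free E X :=
  gen (fun _ _ => False) x

/-- The initial algebra `F(∅)` of constant terms. -/
abbrev const (E : Set (L.Term ℕ × L.Term ℕ)) : VarietyAlg L E := free E PEmpty.{u + 1}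

/-- The unique homomorphism `F(∅) ⟶ A`: the value of a constant in the algebra `A`. -/
def constHom (A : VarietyAlg L E) : const E ⟶ A := presLift PEmpty.elim fun _ _ h => h.elim

/-- The value in `A` of a constant `ω ∈ F(∅)`. -/
def constVal (A : VarietyAlg L E) (ω : const E) : A := (show const E →[L] A from constHom A) ω

/-- The relations that make `a ↦ inl a` and `b ↦ inr b` homomorphisms. -/
inductive SumRel (A B : VarietyAlg L E) : L.Term (A ⊕ B) → L.Term (A ⊕ B) → Prop
  | left {n : ℕ} (f : L.Functions n) (x : Fin n → A) :
      SumRel A B (Term.func f fun i => Term.var (Sum.inl (x i)))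
        (Term.var (Sum.inl (Structure.funMap f x)))
  | right {n : ℕ} (f : L.Functions n) (x : Fin n → B) :
      SumRel A B (Term.func f fun i => Term.var (Sum.inr (x i)))
        (Term.var (Sum.inr (Structure.funMap f x)))

/-- The coproduct `A + B` in the variety. -/
def coprod (A B : VarietyAlg L E) : VarietyAlg L E := pres E (SumRel A B)

/-- The coprojection `A ⟶ A + B`. -/
def inl (A B : VarietyAlg L E) : A ⟶ coprod A B :=
  show A →[L] coprod A B from
  { toFun := fun a => gen (SumRel A B) (Sum.inl a)
    map_fun' := fun f x => ((funMap_quotient_mk' (presSetoid E (SumRel A B)) f _).trans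
      (Quotient.sound (PresRel.rel (SumRel.left f x)))).symm
    map_rel' := fun r => isEmptyElim r }

/-- The coprojection `B ⟶ A + B`. -/
def inr (A B : VarietyAlg L E) : B ⟶ coprod A B :=
  show B →[L] coprod A B from
  { toFun := fun b => gen (SumRel A B) (Sum.inr b)
    map_fun' := fun f x => ((funMap_quotient_mk' (presSetoid E (SumRel A B)) f _).trans
      (Quotient.sound (PresRel.rel (SumRel.right f x)))).symm
    map_rel' := fun r => isEmptyElim r }

/-- The coprojection of `A + B` on an element of `A`. -/
def inlVal {A : VarietyAlg L E} (B : VarietyAlg L E) (a : A) : coprod A B :=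
  (show A →[L] coprod A B from inl A B) a

/-- The coprojection of `A + B` on an element of `B`. -/
def inrVal (A : VarietyAlg L E) {B : VarietyAlg L E} (b : B) : coprod A B :=
  (show B →[L] coprod A B from inr A B) b

/-- The pair `(ω, ω')` of constants as an element of `A + F(∅)²`. -/
def pairVal (A : VarietyAlg L E) (ω ω' : const E) : coprod A (prod (const E) (const E)) :=
  inrVal A (B := prod (const E) (const E)) (ω, ω')

end VarietyAlg

open VarietyAlg

/-- A diagonalizing term of the variety: a `(k+2)`-ary term `t`, `k ≥ 1`, with constants
`e₁, …, e_k, e₁', …, e_k'` in `F(∅)` such that the variety satisfies the identities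
`t(x, y, e₁, …, e_k) = x` and `t(x, y, e₁', …, e_k') = y`. -/
structure DiagonalizingTerm (L : FirstOrder.Language.{u, v}) [L.IsAlgebraic]
    (E : Set (L.Term ℕ × L.Term ℕ)) where
  /-- The number of constants. -/
  k : ℕ
  one_le_k : 1 ≤ k
  /-- The term, in two variables and `k` parameters. -/
  t : L.Term (Fin 2 ⊕ Fin k)
  /-- The first list of constants. -/
  e : Fin k → const E
  /-- The second list of constants. -/
  e' : Fin k → const E
  eq_left : ∀ (A : VarietyAlg L E) (x y : A),
    t.realize (Sum.elim ![x, y] fun i => constVal A (e i)) = x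
  eq_right : ∀ (A : VarietyAlg L E) (x y : A),
    t.realize (Sum.elim ![x, y] fun i => constVal A (e' i)) = y

/-- The map `δ(x, y) = t(x, y, (e₁, e₁'), …, (e_k, e_k'))` on `A + F(∅)²`. -/
def DiagonalizingTerm.delta {L : FirstOrder.Language.{u, v}} [L.IsAlgebraic]
    {E : Set (L.Term ℕ × L.Term ℕ)} (D : DiagonalizingTerm L E) (A : VarietyAlg L E)
    (x y : coprod A (prod (const E) (const E))) : coprod A (prod (const E) (const E)) :=
  D.t.realize (Sum.elim ![x, y] fun i => pairVal A (D.e i) (D.e' i))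

/-! Everything turns on the canonical morphism `splitHom A` from `A + F(∅)²` to `A × A`, which is
the diagonal on `A` and the product of the constant maps on `F(∅)²`.

Coextensivity identifies algebras under `F(∅)²` with pairs of algebras, and forgetting the base then
corresponds to `(P, Q) ↦ P × Q`. The left adjoints `A ↦ A + F(∅)²` and `A ↦ (A, A)` must correspond
too, so `splitHom A` is bijective (`IsCoextensive.bijective_splitHom`). Surjectivity for the free
algebra on two variables yields a diagonalizing term; injectivity for free algebras amounts to the
condition on equations in (2).

Under `splitHom` the map `δ` becomes `((x, x'), (y, y')) ↦ (x, y')`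
(`DiagonalizingTerm.splitHom_delta`). That operation is idempotent and commutes with all operations,
so injectivity pulls both properties back and gives (3).

Conversely, (3) passes from `F(X) + F(∅)²` to every algebra `B` under `F(∅)²`. Then `δ` is an
idempotent homomorphic operation on `B` with `δ(δ(x, y), z) = δ(x, z) = δ(x, δ(y, z))`, a
rectangular band, and so `B` is the product of its quotients by "same first component" and "same
second component". A morphism from `X × Y` to `B` splits accordingly (`exists_prod_decomposition`),
which is essential surjectivity. Morphisms under `X × Y` preserve `δ`, which gives fullness
(`exists_prodMap`). Faithfulness holds because a diagonalizing term supplies a constant, so no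
algebra is empty. -/

namespace FirstOrder.Language.Term

variable {L : FirstOrder.Language.{u, v}}

/-! ### Finitely many variables suffice -/

/-- Only finitely many of the variables indexed by `β` occur in a term. -/
theorem exists_finset_relabel {α β : Type*} (s : L.Term (α ⊕ β)) :
    ∃ T : Finset β, ∀ T' : Finset β, T ⊆ T' →
      ∃ w : L.Term (α ⊕ T'), w.relabel (Sum.map id Subtype.val) = s := by
  classical
  induction s with
  | var x =>
    rcases x with a | b
    · exact ⟨∅, fun T' _ => ⟨var (Sum.inl a), rfl⟩⟩
    · exact ⟨{b}, fun T' h => ⟨var (Sum.inr ⟨b, h (Finset.mem_singleton_self b)⟩), rfl⟩⟩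
  | func f ts ih =>
    choose T hT using ih
    -- Allowing every larger finite set is what lets all the arguments share a single one.
    refine ⟨Finset.univ.biUnion T, fun T' h => ?_⟩
    choose w hw using fun i => hT i T'
      ((Finset.subset_biUnion_of_mem T (Finset.mem_univ i)).trans h)
    exact ⟨func f w, by simp only [relabel, hw]⟩

/-- Two terms use finitely many of the variables indexed by `β`. -/
theorem exists_fin_relabel {α β : Type*} (s s' : L.Term (α ⊕ β)) :
    ∃ (n : ℕ) (b : Fin n → β) (w w' : L.Term (α ⊕ Fin n)),
      w.relabel (Sum.map id b) = s ∧ w'.relabel (Sum.map id b) = s' := by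
  classical
  obtain ⟨T, hT⟩ := exists_finset_relabel s
  obtain ⟨T', hT'⟩ := exists_finset_relabel s'
  obtain ⟨w, rfl⟩ := hT (T ∪ T') Finset.subset_union_left
  obtain ⟨w', rfl⟩ := hT' (T ∪ T') Finset.subset_union_right
  let e := (T ∪ T').equivFin
  refine ⟨_, fun i => (e.symm i : β), w.relabel (Sum.map id e), w'.relabel (Sum.map id e), ?_, ?_⟩
  all_goals
    rw [relabel_relabel]
    congr 1
    ext x
    rcases x with a | b <;> simp

/-- Two terms use finitely many variables of each sort. -/
theorem exists_fin_fin_relabel {α β : Type*} (s s' : L.Term (α ⊕ β)) :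
    ∃ (m n : ℕ) (a : Fin m → α) (b : Fin n → β) (w w' : L.Term (Fin m ⊕ Fin n)),
      w.relabel (Sum.map a b) = s ∧ w'.relabel (Sum.map a b) = s' := by
  obtain ⟨n, b, w, w', rfl, rfl⟩ := exists_fin_relabel s s'
  -- Swapping the summands makes the one-sided statement apply to the variables in `α`.
  obtain ⟨m, a, z, z', hz, hz'⟩ := exists_fin_relabel (w.relabel Sum.swap) (w'.relabel Sum.swap)
  refine ⟨m, n, a, b, z.relabel Sum.swap, z'.relabel Sum.swap, ?_, ?_⟩
  · have := congrArg (relabel (Sum.map id b ∘ Sum.swap)) hz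
    simp only [relabel_relabel] at this ⊢
    convert this using 2
    · ext x; rcases x with x | x <;> rfl
    · ext x; rcases x with x | x <;> rfl
  · have := congrArg (relabel (Sum.map id b ∘ Sum.swap)) hz'
    simp only [relabel_relabel] at this ⊢
    convert this using 2
    · ext x; rcases x with x | x <;> rfl
    · ext x; rcases x with x | x <;> rfl

end FirstOrder.Language.Term

/-! ### Morphisms of algebras as functions -/

namespace VarietyAlg

variable {L : FirstOrder.Language.{u, v}} {E : Set (L.Term ℕ × L.Term ℕ)}

/-- The underlying function of a morphism of algebras. -/
def app {A B : VarietyAlg L E} (f : A ⟶ B) (a : A) : B := (show A →[L] B from f) a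

@[simp] theorem app_id (A : VarietyAlg L E) (a : A) : app (𝟙 A) a = a := rfl

@[simp] theorem app_comp {A B C : VarietyAlg L E} (f : A ⟶ B) (g : B ⟶ C) (a : A) :
    app (f ≫ g) a = app g (app f a) := rfl

theorem hom_ext {A B : VarietyAlg L E} {f g : A ⟶ B} (h : ∀ a, app f a = app g a) : f = g :=
  FirstOrder.Language.Hom.ext h

theorem app_funMap {A B : VarietyAlg L E} (f : A ⟶ B) {n : ℕ} (φ : L.Functions n)
    (x : Fin n → A) :
    app f (Structure.funMap φ x) = Structure.funMap φ fun i => app f (x i) :=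
  (show A →[L] B from f).map_fun φ x

theorem app_realize {A B : VarietyAlg L E} (f : A ⟶ B) {α : Type*} (t : L.Term α) (x : α → A) :
    app f (t.realize x) = t.realize fun i => app f (x i) :=
  (HomClass.realize_term (show A →[L] B from f)).symm

theorem bijective_app_of_isIso {A B : VarietyAlg L E} (f : A ⟶ B) [IsIso f] :
    Function.Bijective (app f) :=
  Function.bijective_iff_has_inverse.2 ⟨app (inv f),
    fun a => by rw [← app_comp, IsIso.hom_inv_id, app_id],
    fun a => by rw [← app_comp, IsIso.inv_hom_id, app_id]⟩

variable [L.IsAlgebraic]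

/-- A map that commutes with the operations is a morphism of algebras. -/
def mkHom {A B : VarietyAlg L E} (f : A → B)
    (h : ∀ {n : ℕ} (φ : L.Functions n) (x : Fin n → A),
      f (Structure.funMap φ x) = Structure.funMap φ fun i => f (x i)) : A ⟶ B :=
  show A →[L] B from
  { toFun := f
    map_fun' := h
    map_rel' := fun r => isEmptyElim r }

theorem isIso_of_bijective {A B : VarietyAlg L E} (f : A ⟶ B) (h : Function.Bijective (app f)) :
    IsIso f := by
  obtain ⟨g, hl, hr⟩ := Function.bijective_iff_has_inverse.1 h
  refine ⟨mkHom g fun φ x => h.1 ?_, hom_ext hl, hom_ext hr⟩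
  rw [hr, app_funMap]
  exact congrArg _ (funext fun i => (hr _).symm)

/-! ### Products -/

/-- The first projection. -/
def prodFst (A B : VarietyAlg L E) : prod A B ⟶ A := mkHom Prod.fst fun _ _ => rfl

/-- The second projection. -/
def prodSnd (A B : VarietyAlg L E) : prod A B ⟶ B := mkHom Prod.snd fun _ _ => rfl

/-- The morphism into a product with given components. -/
def prodLift {T A B : VarietyAlg L E} (f : T ⟶ A) (g : T ⟶ B) : T ⟶ prod A B :=
  mkHom (B := prod A B) (fun x => (app f x, app g x)) fun φ x =>
    Prod.ext (app_funMap f φ x) (app_funMap g φ x)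

/-- The product of two morphisms. -/
def prodMap {A B A' B' : VarietyAlg L E} (f : A ⟶ A') (g : B ⟶ B') : prod A B ⟶ prod A' B' :=
  prodLift (prodFst A B ≫ f) (prodSnd A B ≫ g)

/-- The cartesian product is a categorical product. -/
def prodIsLimit (A B : VarietyAlg L E) :
    Limits.IsLimit (Limits.BinaryFan.mk (prodFst A B) (prodSnd A B)) :=
  Limits.BinaryFan.IsLimit.mk _ (fun f g => prodLift f g) (fun _ _ => rfl) (fun _ _ => rfl)
    fun _ _ _ hf hg => hom_ext fun x =>
      Prod.ext (congrArg (fun k => app k x) hf) (congrArg (fun k => app k x) hg)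

/-- The one-element algebra. -/
def unit (L : FirstOrder.Language.{u, v}) [L.IsAlgebraic] (E : Set (L.Term ℕ × L.Term ℕ)) :
    VarietyAlg L E where
  carrier := PUnit
  str := { funMap := fun _ _ => PUnit.unit, RelMap := fun r => isEmptyElim r }
  sat _ _ _ := rfl

instance : Subsingleton (unit L E) := inferInstanceAs (Subsingleton PUnit)

instance : Nonempty (unit L E) := inferInstanceAs (Nonempty PUnit)

/-- The one-element algebra is terminal. -/
def unitIsTerminal : Limits.IsTerminal (unit L E) :=
  Limits.IsTerminal.ofUniqueHom
    (fun _ => mkHom (fun _ => (PUnit.unit : PUnit)) fun _ _ => Subsingleton.elim _ _)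
    fun _ _ => hom_ext fun _ => Subsingleton.elim _ _

theorem hasFiniteProducts : Limits.HasFiniteProducts (VarietyAlg L E) := by
  have : Limits.HasTerminal (VarietyAlg L E) := unitIsTerminal.hasTerminal
  have : ∀ {X Y : VarietyAlg L E}, Limits.HasLimit (Limits.pair X Y) :=
    fun {X Y} => ⟨⟨⟨_, prodIsLimit X Y⟩⟩⟩
  have := Limits.hasBinaryProducts_of_hasLimit_pair (VarietyAlg L E)
  exact hasFiniteProducts_of_has_binary_and_terminal

/-- The comparison of the chosen categorical product with the cartesian product. -/
noncomputable def prodIso [Limits.HasFiniteProducts (VarietyAlg L E)] (A B : VarietyAlg L E) :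
    Limits.prod A B ≅ prod A B :=
  (Limits.prodIsProd A B).conePointUniqueUpToIso (prodIsLimit A B)

theorem app_prodIso_hom [Limits.HasFiniteProducts (VarietyAlg L E)] (A B : VarietyAlg L E)
    (x : (Limits.prod A B : VarietyAlg L E).carrier) :
    app (prodIso A B).hom x =
      ((app (Limits.prod.fst : Limits.prod A B ⟶ A) x,
        app (Limits.prod.snd : Limits.prod A B ⟶ B) x) : A × B) :=
  Prod.ext
    (congrArg (fun k => app k x) ((Limits.prodIsProd A B).conePointUniqueUpToIso_hom_comp
      (prodIsLimit A B) ⟨Limits.WalkingPair.left⟩))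
    (congrArg (fun k => app k x) ((Limits.prodIsProd A B).conePointUniqueUpToIso_hom_comp
      (prodIsLimit A B) ⟨Limits.WalkingPair.right⟩))

/-- Since `underProd` uses an arbitrarily chosen categorical product, this naturality is what
reduces questions about it to pairs of elements. -/
theorem prodMap_prodIso [Limits.HasFiniteProducts (VarietyAlg L E)] {A B A' B' : VarietyAlg L E}
    (f : A ⟶ A') (g : B ⟶ B') :
    Limits.prod.map f g ≫ (prodIso A' B').hom = (prodIso A B).hom ≫ prodMap f g := by
  refine hom_ext fun x => ?_
  simp only [app_comp, app_prodIso_hom]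
  simp only [← app_comp, Limits.prod.map_fst, Limits.prod.map_snd]
  rfl

end VarietyAlg

namespace VarietyAlg

variable {L : FirstOrder.Language.{u, v}} {E : Set (L.Term ℕ × L.Term ℕ)} [L.IsAlgebraic]

/-! ### Presented algebras, free algebras and coproducts -/

theorem exists_realize_gen {G : Type u} (R : L.Term G → L.Term G → Prop) (w : pres E R) :
    ∃ s : L.Term G, s.realize (gen R) = w := by
  have subst_var : ∀ s : L.Term G, s.subst Term.var = s := by
    intro s
    induction s with
    | var => rfl
    | func f ts ih => simp only [Term.subst, ih]
  obtain ⟨s, rfl⟩ := Quotient.exists_rep w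
  exact ⟨s, (realize_pres R s Term.var).trans (by rw [subst_var])⟩

theorem pres_hom_ext {G : Type u} {R : L.Term G → L.Term G → Prop} {A : VarietyAlg L E}
    {f g : pres E R ⟶ A} (h : ∀ x, app f (gen R x) = app g (gen R x)) : f = g := by
  refine hom_ext fun w => ?_
  obtain ⟨s, rfl⟩ := exists_realize_gen R w
  simp only [app_realize, h]

/-- The morphism out of a free algebra with given values on the variables. -/
def freeLift {X : Type u} {A : VarietyAlg L E} (φ : X → A) : free E X ⟶ A :=
  presLift φ fun _ _ h => h.elim

theorem const_hom_ext {A : VarietyAlg L E} (f g : const E ⟶ A) : f = g :=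
  pres_hom_ext fun x => x.elim

@[simp] theorem app_const {A : VarietyAlg L E} (f : const E ⟶ A) (ω : const E) :
    app f ω = constVal A ω := congrArg (fun k => app k ω) (const_hom_ext f (constHom A))

@[simp] theorem app_constVal {A B : VarietyAlg L E} (f : A ⟶ B) (ω : const E) :
    app f (constVal A ω) = constVal B ω := app_const (constHom A ≫ f) ω

theorem constVal_const (ω : const E) : constVal (const E) ω = ω := (app_const (𝟙 _) ω).symm

theorem constVal_prod (A B : VarietyAlg L E) (ω : const E) :
    constVal (prod A B) ω = ((constVal A ω, constVal B ω) : A × B) :=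
  (app_const (prodLift (constHom A) (constHom B)) ω).symm

/-- The morphism out of a coproduct with given components. -/
def coprodDesc {A B C : VarietyAlg L E} (f : A ⟶ C) (g : B ⟶ C) : coprod A B ⟶ C :=
  presLift (Sum.elim (app f) (app g)) fun _ _ h => by
    cases h with
    | left φ x => exact (app_funMap f φ x).symm
    | right φ x => exact (app_funMap g φ x).symm

theorem coprod_hom_ext {A B C : VarietyAlg L E} {f g : coprod A B ⟶ C}
    (hl : inl A B ≫ f = inl A B ≫ g) (hr : inr A B ≫ f = inr A B ≫ g) : f = g :=
  pres_hom_ext fun x => by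
    rcases x with a | b
    · exact congrArg (fun k => app k a) hl
    · exact congrArg (fun k => app k b) hr

/-- Generators coming from `F(X)` are themselves terms in the variables and can be substituted away;
generators from `B` remain as parameters. -/
theorem exists_realize_coprod_free {X : Type u} {B : VarietyAlg L E} (w : coprod (free E X) B) :
    ∃ s : L.Term (X ⊕ B),
      s.realize (Sum.elim (fun x => inlVal B (freeVar E x)) (inrVal (free E X))) = w := by
  obtain ⟨s, rfl⟩ := exists_realize_gen _ w
  choose r hr using fun a : free E X => exists_realize_gen (fun _ _ => False) a
  refine ⟨s.subst (Sum.elim (fun a => (r a).relabel Sum.inl) fun b => Term.var (Sum.inr b)), ?_⟩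
  rw [Term.realize_subst]
  congr 1
  ext x
  rcases x with a | b
  · simp only [Sum.elim_inl, Term.realize_relabel]
    exact (app_realize (inl (free E X) B) (r a) (freeVar E)).symm.trans
      (congrArg (app (inl (free E X) B)) (hr a))
  · rfl

/-! ### The comparison `A + F(∅)² ⟶ A × A` -/

/-- The square `F(∅)²` of the initial algebra. -/
abbrev constSq (E : Set (L.Term ℕ × L.Term ℕ)) : VarietyAlg L E := prod (const E) (const E)

/-- The canonical morphism `A + F(∅)² ⟶ A × A`. -/
def splitHom (A : VarietyAlg L E) : coprod A (constSq E) ⟶ prod A A :=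
  coprodDesc (prodLift (𝟙 A) (𝟙 A)) (prodMap (constHom A) (constHom A))

theorem realize_prod {A B : VarietyAlg L E} {α : Type*} (t : L.Term α) (x : α → prod A B) :
    t.realize x = ((t.realize fun i => (x i).1, t.realize fun i => (x i).2) : A × B) :=
  Prod.ext (app_realize (prodFst A B) t x) (app_realize (prodSnd A B) t x)

end VarietyAlg

/-! ### The operation of a diagonalizing term -/

namespace DiagonalizingTerm

variable {L : FirstOrder.Language.{u, v}} [L.IsAlgebraic] {E : Set (L.Term ℕ × L.Term ℕ)}
  (D : DiagonalizingTerm L E)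

/-- The operation `t(x, y, (e₁, e₁'), …, (e_k, e_k'))` on an algebra under `F(∅)²`. -/
def diag {B : VarietyAlg L E} (g : constSq E ⟶ B) (x y : B) : B :=
  D.t.realize (Sum.elim ![x, y] fun i => app g ((D.e i, D.e' i) : const E × const E))

theorem delta_eq_diag (A : VarietyAlg L E) : D.delta A = D.diag (inr A (constSq E)) := rfl

theorem app_diag {B C : VarietyAlg L E} (g : constSq E ⟶ B) (h : B ⟶ C) (x y : B) :
    app h (D.diag g x y) = D.diag (g ≫ h) (app h x) (app h y) := by
  unfold diag
  rw [app_realize]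
  congr 1
  ext i
  rcases i with i | i
  · fin_cases i <;> rfl
  · rfl

/-- On a product, with parameters `(e, e')` componentwise, the operation combines the first
component of one argument with the second component of the other. -/
theorem diag_prod {P Q : VarietyAlg L E} (x y : prod P Q) :
    D.diag (prodMap (constHom P) (constHom Q)) x y = ((x.1, y.2) : P × Q) := by
  unfold diag
  rw [realize_prod]
  refine Prod.ext ?_ ?_
  · refine Eq.trans ?_ (D.eq_left P x.1 y.1)
    refine congrArg D.t.realize (funext fun i => ?_)
    rcases i with i | i
    · fin_cases i <;> rfl
    · rfl
  · refine Eq.trans ?_ (D.eq_right Q x.2 y.2)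
    refine congrArg D.t.realize (funext fun i => ?_)
    rcases i with i | i
    · fin_cases i <;> rfl
    · rfl

/-- `splitHom` carries the parameters `(e, e')` to the constants `e` in the first and `e'` in the
second factor, so `diag_prod` applies. -/
theorem splitHom_delta (A : VarietyAlg L E) (x y : coprod A (constSq E)) :
    app (splitHom A) (D.delta A x y) =
      (((app (splitHom A) x).1, (app (splitHom A) y).2) : A × A) := by
  rw [delta_eq_diag, app_diag]
  exact D.diag_prod _ _

end DiagonalizingTerm

section
variable {L : FirstOrder.Language.{u, v}} [L.IsAlgebraic] {E : Set (L.Term ℕ × L.Term ℕ)}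

/-! ### Consequences of coextensivity -/

/-- If `F(∅)` were empty, multiplying `F(∅) ⟶ 1` by the identity of `F(∅)` would give a map between
empty algebras, hence an isomorphism. An equivalence reflects isomorphisms, so `F(∅) ⟶ 1` would be
one, which is absurd. -/
theorem IsCoextensive.nonempty_const (h : IsCoextensive (VarietyAlg L E)) :
    Nonempty (const E) := by
  obtain ⟨_, h⟩ := h
  by_contra hne
  rw [not_nonempty_iff] at hne
  have := h (const E) (const E)
  let φ : ((Under.mk (𝟙 (const E)), Under.mk (𝟙 (const E))) :
      Under (const E) × Under (const E)) ⟶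
      (Under.mk (𝟙 (const E)), Under.mk (constHom (unit L E))) :=
    (𝟙 _, Under.homMk (constHom (unit L E)) (const_hom_ext _ _))
  have hφ : IsIso ((underProd (const E) (const E)).map φ).right := by
    refine isIso_of_bijective _ ⟨fun x => ?_, fun y => ?_⟩
    · exact (hne.false (app Limits.prod.fst x)).elim
    · exact (hne.false (app Limits.prod.fst y)).elim
  have hφ' : IsIso ((underProd (const E) (const E)).map φ) := by
    have : IsIso ((Under.forget _).map ((underProd (const E) (const E)).map φ)) := hφ
    exact isIso_of_reflects_iso _ (Under.forget _)
  have hiso : IsIso φ := isIso_of_reflects_iso φ (underProd (const E) (const E))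
  have h2 : IsIso ((CategoryTheory.Prod.snd _ _ ⋙ Under.forget _).map φ) := inferInstance
  have h3 : IsIso (constHom (unit L E)) := h2
  obtain ⟨x, -⟩ := (bijective_app_of_isIso (constHom (unit L E))).2
    (Classical.arbitrary (unit L E))
  exact hne.false x

/-- Essential surjectivity writes `A + F(∅)²` as a product `P × Q` under `F(∅)²`. The comparison
with `A × A` then splits into two components, each of which turns out to be invertible. -/
theorem IsCoextensive.bijective_splitHom (h : IsCoextensive (VarietyAlg L E))
    (A : VarietyAlg L E) : Function.Bijective (app (splitHom A)) := by
  obtain ⟨_, h⟩ := h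
  have := h (const E) (const E)
  let I := const E
  let e := prodIso I I
  let F := underProd I I
  let b : Under (Limits.prod I I) := Under.mk (e.hom ≫ inr A (constSq E))
  let P := (F.objPreimage b).1
  let Q := (F.objPreimage b).2
  let ψ : Limits.prod P.right Q.right ≅ coprod A (constSq E) :=
    (Under.forget _).mapIso (F.objObjPreimageIso b)
  have hψ : Limits.prod.map P.hom Q.hom ≫ ψ.hom = e.hom ≫ inr A (constSq E) :=
    Under.w (F.objObjPreimageIso b).hom
  have hψ' : e.hom ≫ inr A (constSq E) ≫ ψ.inv = Limits.prod.map P.hom Q.hom := by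
    rw [← Category.assoc, ← hψ, Category.assoc, ψ.hom_inv_id, Category.comp_id]
  -- The components of the coprojection of `A` are the future inverses of `r` and `s`.
  let p : A ⟶ P.right := inl A (constSq E) ≫ ψ.inv ≫ Limits.prod.fst
  let q : A ⟶ Q.right := inl A (constSq E) ≫ ψ.inv ≫ Limits.prod.snd
  let M : coprod A (constSq E) ⟶ Limits.prod A A := splitHom A ≫ (prodIso A A).inv
  have hM : e.hom ≫ inr A (constSq E) ≫ M = Limits.prod.map (constHom A) (constHom A) := by
    have : inr A (constSq E) ≫ splitHom A = prodMap (constHom A) (constHom A) := rfl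
    rw [← Category.assoc (inr A (constSq E)), this, ← Category.assoc, ← prodMap_prodIso,
      Category.assoc, Iso.hom_inv_id, Category.comp_id]
  -- Fullness splits the comparison `P × Q ⟶ A × A` into a product of morphisms.
  obtain ⟨ρ, hρ⟩ := F.map_surjective (X := (P, Q))
    (Y := (Under.mk (constHom A), Under.mk (constHom A)))
    (Under.homMk (ψ.hom ≫ M) (by
      change Limits.prod.map P.hom Q.hom ≫ ψ.hom ≫ M = Limits.prod.map (constHom A) (constHom A)
      rw [← Category.assoc, hψ, Category.assoc, hM]))
  let r : P.right ⟶ A := ρ.1.right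
  let s : Q.right ⟶ A := ρ.2.right
  have hrs : Limits.prod.map r s = ψ.hom ≫ M := congrArg CommaMorphism.right hρ
  have hinl : inl A (constSq E) ≫ M = Limits.prod.lift (𝟙 A) (𝟙 A) := by
    have h1 : inl A (constSq E) ≫ splitHom A = prodLift (𝟙 A) (𝟙 A) := rfl
    rw [← Category.assoc, h1, Iso.comp_inv_eq]
    refine hom_ext fun x => ?_
    rw [app_comp, app_prodIso_hom]
    simp only [← app_comp, Limits.prod.lift_fst, Limits.prod.lift_snd]
    rfl
  have hlift : inl A (constSq E) ≫ ψ.inv = Limits.prod.lift p q := by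
    refine Limits.prod.hom_ext ?_ ?_
    · rw [Limits.prod.lift_fst, Category.assoc]
    · rw [Limits.prod.lift_snd, Category.assoc]
  have hpq : Limits.prod.lift p q ≫ Limits.prod.map r s = Limits.prod.lift (𝟙 A) (𝟙 A) := by
    rw [← hlift, hrs, Category.assoc, Iso.inv_hom_id_assoc, hinl]
  rw [Limits.prod.lift_map] at hpq
  have hp : p ≫ r = 𝟙 A := by
    rw [← Limits.prod.lift_fst (p ≫ r) (q ≫ s), hpq, Limits.prod.lift_fst]
  have hq : q ≫ s = 𝟙 A := by
    rw [← Limits.prod.lift_snd (p ≫ r) (q ≫ s), hpq, Limits.prod.lift_snd]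
  -- Tested on the two coprojections: on `A` this is `hp` and `hq`, on `F(∅)²` it is initiality of
  -- `F(∅)`.
  have hid : Limits.prod.map (r ≫ p) (s ≫ q) = 𝟙 _ := by
    rw [← cancel_epi ψ.inv, Category.comp_id]
    refine coprod_hom_ext ?_ ?_
    · rw [← Category.assoc, hlift, Limits.prod.lift_map, ← Category.assoc p, hp,
        ← Category.assoc q, hq, Category.id_comp, Category.id_comp]
    · rw [← cancel_epi e.hom, hψ', ← Category.assoc (inr A (constSq E)), ← Category.assoc, hψ',
        Limits.prod.map_map]
      congr 1 <;> exact const_hom_ext _ _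
  -- Faithfulness separates the product identity `hid` into its two factors.
  have hrp : ∀ k : (P, Q) ⟶ (P, Q), k.1.right = r ≫ p → k.2.right = s ≫ q → k = 𝟙 _ := by
    intro k h1 h2
    apply F.map_injective
    rw [F.map_id]
    refine Under.UnderMorphism.ext ?_
    change Limits.prod.map k.1.right k.2.right = 𝟙 _
    rw [h1, h2, hid]
  have hk := hrp (Under.homMk (r ≫ p) (const_hom_ext (E := E) _ _),
    Under.homMk (s ≫ q) (const_hom_ext (E := E) _ _)) rfl rfl
  have hr : r ≫ p = 𝟙 _ := congrArg (fun k : (P, Q) ⟶ (P, Q) => k.1.right) hk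
  have hs : s ≫ q = 𝟙 _ := congrArg (fun k : (P, Q) ⟶ (P, Q) => k.2.right) hk
  have : IsIso r := ⟨p, hr, hp⟩
  have : IsIso s := ⟨q, hs, hq⟩
  have hsplit : splitHom A = ψ.inv ≫ Limits.prod.map r s ≫ (prodIso A A).hom := by
    rw [hrs]
    simp [M]
  rw [hsplit]
  exact bijective_app_of_isIso _

/-- A preimage of `(x₀, x₁)` under `splitHom` of the free algebra on `x₀, x₁` is a term in these
variables and pairs of constants. Its two projections are the two required identities. -/
theorem IsCoextensive.nonempty_diagonalizingTerm (h : IsCoextensive (VarietyAlg L E)) :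
    Nonempty (DiagonalizingTerm L E) := by
  obtain ⟨ω₀⟩ := h.nonempty_const
  let X := ULift.{u} (Fin 2)
  obtain ⟨w, hw⟩ := (h.bijective_splitHom (free E X)).2
    ((freeVar E ⟨0⟩, freeVar E ⟨1⟩) : free E X × free E X)
  obtain ⟨s, rfl⟩ := exists_realize_coprod_free w
  obtain ⟨n, b, t, -, rfl, -⟩ := Term.exists_fin_relabel s s
  have key : ∀ (A : VarietyAlg L E) (x y : A),
      (t.realize (Sum.elim (fun i => ![x, y] i.down) fun j => constVal A (b j).1) = x) ∧
      (t.realize (Sum.elim (fun i => ![x, y] i.down) fun j => constVal A (b j).2) = y) := by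
    intro A x y
    let ρ : free E X ⟶ A := freeLift fun i => ![x, y] i.down
    have hρ := congrArg (app (prodMap ρ ρ)) hw
    rw [Term.realize_relabel, app_realize, app_realize, realize_prod] at hρ
    have h1 := congrArg Prod.fst hρ
    have h2 := congrArg Prod.snd hρ
    refine ⟨Eq.trans ?_ h1, Eq.trans ?_ h2⟩
    all_goals
      refine congrArg t.realize (funext fun i => ?_)
      rcases i with i | i
      · rfl
      · exact (app_constVal ρ _).symm
  -- The term may involve no constants at all, so `ω₀` is added as a dummy parameter in position `0`
  -- to ensure `k ≥ 1`.
  refine ⟨⟨n + 1, Nat.succ_pos n, t.relabel (Sum.map ULift.down Fin.succ),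
    Fin.cons ω₀ fun j => (b j).1, Fin.cons ω₀ fun j => (b j).2, fun A x y => ?_, fun A x y => ?_⟩⟩
  · refine Eq.trans ?_ (key A x y).1
    rw [Term.realize_relabel]
    refine congrArg t.realize (funext fun i => ?_)
    rcases i with i | i <;> rfl
  · refine Eq.trans ?_ (key A x y).2
    rw [Term.realize_relabel]
    refine congrArg t.realize (funext fun i => ?_)
    rcases i with i | i <;> rfl

/-! ### Equations between terms in paired constants -/

variable (L E) in
/-- An equation in generators and constants holds in `FU(A) + F(∅)²` for pairs of constants if it
holds in `FU(A)` for both lists of components. -/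
def PairedEquations : Prop :=
  ∀ (A : VarietyAlg L E) (m n : ℕ) (u v : L.Term (Fin m ⊕ Fin n))
    (a : Fin m → A) (ω ω' : Fin n → const E),
    u.realize (Sum.elim (fun i => freeVar E (a i)) fun j => constVal (free E A) (ω j)) =
      v.realize (Sum.elim (fun i => freeVar E (a i)) fun j => constVal (free E A) (ω j)) →
    u.realize (Sum.elim (fun i => freeVar E (a i)) fun j => constVal (free E A) (ω' j)) =
      v.realize (Sum.elim (fun i => freeVar E (a i)) fun j => constVal (free E A) (ω' j)) →
    u.realize (Sum.elim (fun i => inlVal _ (freeVar E (a i)))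
        fun j => pairVal (free E A) (ω j) (ω' j)) =
      v.realize (Sum.elim (fun i => inlVal _ (freeVar E (a i)))
        fun j => pairVal (free E A) (ω j) (ω' j))

theorem splitHom_realize (A : VarietyAlg L E) {α β : Type*} (t : L.Term (α ⊕ β))
    (a : α → A) (ω ω' : β → const E) :
    app (splitHom A) (t.realize (Sum.elim (fun i => inlVal _ (a i))
        fun j => pairVal A (ω j) (ω' j))) =
      ((t.realize (Sum.elim a fun j => constVal A (ω j)),
        t.realize (Sum.elim a fun j => constVal A (ω' j))) : A × A) := by
  rw [app_realize, realize_prod]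
  refine Prod.ext ?_ ?_
  all_goals
    refine congrArg t.realize (funext fun i => ?_)
    rcases i with i | i <;> rfl

theorem PairedEquations.of_injective
    (h : ∀ A : VarietyAlg L E, Function.Injective (app (splitHom A))) : PairedEquations L E := by
  intro A m n u v a ω ω' h1 h2
  apply h
  rw [splitHom_realize, splitHom_realize]
  exact Prod.ext h1 h2

/-- Two elements with equal image are two terms in variables and pairs of constants that agree for
both lists of components, which is the situation of `PairedEquations`. -/
theorem PairedEquations.injective_splitHom (h : PairedEquations L E) (X : Type u) :
    Function.Injective (app (splitHom (free E X))) := by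
  intro w w' hw
  obtain ⟨s, rfl⟩ := exists_realize_coprod_free w
  obtain ⟨s', rfl⟩ := exists_realize_coprod_free w'
  obtain ⟨m, n, a, b, t, t', rfl, rfl⟩ := Term.exists_fin_fin_relabel s s'
  have hval : ∀ t : L.Term (Fin m ⊕ Fin n),
      (t.relabel (Sum.map a b)).realize (Sum.elim (fun x => inlVal _ (freeVar E x))
        (inrVal (free E X))) = t.realize (Sum.elim (fun i => inlVal _ (freeVar E (a i)))
          fun j => pairVal (free E X) (b j).1 (b j).2) := by
    intro t
    rw [Term.realize_relabel]
    refine congrArg t.realize (funext fun i => ?_)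
    rcases i with i | i <;> rfl
  rw [hval, hval] at hw ⊢
  rw [splitHom_realize, splitHom_realize] at hw
  -- `PairedEquations` speaks of `FU(A)`, here with `A = F(X)`: `η` carries the equations there and
  -- the counit `ε` brings the conclusion back.
  let η : free E X ⟶ free E (free E X) := freeLift fun x => freeVar E (freeVar E x)
  let ε : free E (free E X) ⟶ free E X := freeLift id
  have hη : ∀ (t : L.Term (Fin m ⊕ Fin n)) (ω : Fin n → const E),
      app η (t.realize (Sum.elim (fun i => freeVar E (a i)) fun j => constVal (free E X) (ω j))) =
        t.realize (Sum.elim (fun i => freeVar E (freeVar E (a i)))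
          fun j => constVal (free E (free E X)) (ω j)) := by
    intro t ω
    rw [app_realize]
    refine congrArg t.realize (funext fun i => ?_)
    rcases i with i | i
    · rfl
    · exact app_constVal η _
  have heq := h (free E X) m n t t' (fun i => freeVar E (a i)) (fun j => (b j).1)
    (fun j => (b j).2)
    (by rw [← hη, ← hη]; exact congrArg (app η) (congrArg Prod.fst hw))
    (by rw [← hη, ← hη]; exact congrArg (app η) (congrArg Prod.snd hw))
  have hε : ∀ t : L.Term (Fin m ⊕ Fin n),
      app (coprodDesc (ε ≫ inl (free E X) (constSq E)) (inr (free E X) (constSq E)))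
        (t.realize (Sum.elim (fun i => inlVal _ (freeVar E (freeVar E (a i))))
          fun j => pairVal (free E (free E X)) (b j).1 (b j).2)) =
        t.realize (Sum.elim (fun i => inlVal _ (freeVar E (a i)))
          fun j => pairVal (free E X) (b j).1 (b j).2) := by
    intro t
    rw [app_realize]
    refine congrArg t.realize (funext fun i => ?_)
    rcases i with i | i <;> rfl
  rw [← hε, ← hε]
  exact congrArg _ heq

/-! ### Idempotence and compatibility of `δ` -/

/-- `δ` is idempotent and commutes with all operations on `F(X) + F(∅)²`. -/
def DiagonalizingTerm.IsRectangular (D : DiagonalizingTerm L E) : Prop :=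
  ∀ X : Type u, (∀ x, D.delta (free E X) x x = x) ∧
    ∀ (n : ℕ) (u : L.Term (Fin n)) (x y : Fin n → coprod (free E X) (constSq E)),
      u.realize (fun i => D.delta (free E X) (x i) (y i)) =
        D.delta (free E X) (u.realize x) (u.realize y)

/-- Both laws may be checked after the injective `splitHom`, where `δ` keeps the first component of
one argument and the second of the other. -/
theorem PairedEquations.isRectangular (h : PairedEquations L E) (D : DiagonalizingTerm L E) :
    D.IsRectangular := by
  refine fun X => ⟨fun x => h.injective_splitHom X ?_, fun n u x y => h.injective_splitHom X ?_⟩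
  · exact D.splitHom_delta _ x x
  · let p := splitHom (free E X) ≫ prodFst _ _
    let q := splitHom (free E X) ≫ prodSnd _ _
    have hp : ∀ x y, app p (D.delta (free E X) x y) = app p x := by
      intro x y
      have h := congrArg (app (prodFst (free E X) (free E X))) (D.splitHom_delta (free E X) x y)
      exact h
    have hq : ∀ x y, app q (D.delta (free E X) x y) = app q y := by
      intro x y
      have h := congrArg (app (prodSnd (free E X) (free E X))) (D.splitHom_delta (free E X) x y)
      exact h
    refine Prod.ext ?_ ?_
    · change app p _ = app p _
      simp only [hp, app_realize]
    · change app q _ = app q _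
      simp only [hq, app_realize]

end

section
variable {L : FirstOrder.Language.{u, v}} {E : Set (L.Term ℕ × L.Term ℕ)}

namespace VarietyAlg

/-! ### Quotient algebras -/

section
variable (A : VarietyAlg L E) (s : Setoid A)

/-- The operations on the classes of an equivalence relation. -/
@[reducible] noncomputable def quotientStructure [L.IsAlgebraic] : L.Structure (Quotient s) where
  funMap φ x := Quotient.mk s (Structure.funMap φ fun i => (x i).out)
  RelMap r := isEmptyElim r

variable {A s}

/-- Compatibility with the operations makes the representatives chosen in `quotientStructure`
irrelevant. -/
theorem mk_funMap [L.IsAlgebraic] (h : ∀ {n : ℕ} (φ : L.Functions n) (x y : Fin n → A),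
    (∀ i, s (x i) (y i)) → s (Structure.funMap φ x) (Structure.funMap φ y))
    {n : ℕ} (φ : L.Functions n) (x : Fin n → A) :
    Quotient.mk s (Structure.funMap φ x) =
      (quotientStructure A s).funMap φ fun i => Quotient.mk s (x i) :=
  Quotient.sound (h φ _ _ fun i => Setoid.symm (Quotient.mk_out (x i)))

/-- The quotient of an algebra by a congruence. -/
noncomputable def quotient [L.IsAlgebraic] (h : ∀ {n : ℕ} (φ : L.Functions n) (x y : Fin n → A),
    (∀ i, s (x i) (y i)) → s (Structure.funMap φ x) (Structure.funMap φ y)) :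
    VarietyAlg L E where
  carrier := Quotient s
  str := quotientStructure A s
  sat p hp x := by
    let := quotientStructure A s
    have key : ∀ t : L.Term ℕ, t.realize x = Quotient.mk s (t.realize fun i => (x i).out) := by
      intro t
      induction t with
      | var i => exact (Quotient.out_eq _).symm
      | func φ ts ih =>
        simp only [Term.realize_func, ih]
        exact (mk_funMap h φ _).symm
    rw [key, key, A.sat p hp]

/-- The projection to the quotient by a congruence. -/
noncomputable def quotientMk [L.IsAlgebraic] (h : ∀ {n : ℕ} (φ : L.Functions n) (x y : Fin n → A),
    (∀ i, s (x i) (y i)) → s (Structure.funMap φ x) (Structure.funMap φ y)) :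
    A ⟶ quotient h :=
  mkHom (B := quotient h) (fun a => Quotient.mk s a) fun φ x => mk_funMap h φ x

end

variable [L.IsAlgebraic]

/-! ### Morphisms out of products -/

/-- A morphism from a product that does not depend on the second variable factors through the
first projection. -/
theorem exists_prodFst_comp {X Y P : VarietyAlg L E} [Nonempty Y] (k : prod X Y ⟶ P)
    (h : ∀ (x : X) (y y' : Y), app k ((x, y) : X × Y) = app k ((x, y') : X × Y)) :
    ∃ p : X ⟶ P, k = prodFst X Y ≫ p := by
  obtain ⟨c⟩ := ‹Nonempty Y›
  refine ⟨mkHom (fun x => app k ((x, c) : X × Y)) fun φ x => ?_, hom_ext fun a => h a.1 a.2 c⟩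
  exact (h _ _ _).trans (app_funMap k φ fun i => ((x i, c) : X × Y))

/-- A morphism from a product that does not depend on the first variable factors through the
second projection. -/
theorem exists_prodSnd_comp {X Y P : VarietyAlg L E} [Nonempty X] (k : prod X Y ⟶ P)
    (h : ∀ (x x' : X) (y : Y), app k ((x, y) : X × Y) = app k ((x', y) : X × Y)) :
    ∃ p : Y ⟶ P, k = prodSnd X Y ≫ p := by
  obtain ⟨c⟩ := ‹Nonempty X›
  refine ⟨mkHom (fun y => app k ((c, y) : X × Y)) fun φ x => ?_, hom_ext fun a => h a.1 c a.2⟩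
  exact (h _ _ _).trans (app_funMap k φ fun i => ((c, x i) : X × Y))

/-- A point of one factor is needed to recover the morphism on the other; with an empty factor this
fails. -/
theorem prodMap_injective {X Y X' Y' : VarietyAlg L E} [Nonempty X] [Nonempty Y]
    {r r' : X ⟶ X'} {s s' : Y ⟶ Y'} (h : prodMap r s = prodMap r' s') : r = r' ∧ s = s' := by
  obtain ⟨x₀⟩ := ‹Nonempty X›
  obtain ⟨y₀⟩ := ‹Nonempty Y›
  refine ⟨hom_ext fun x => ?_, hom_ext fun y => ?_⟩
  · have hx := congrArg (fun k : prod X Y ⟶ prod X' Y' => (app k ((x, y₀) : X × Y)).1) h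
    exact hx
  · have hy := congrArg (fun k : prod X Y ⟶ prod X' Y' => (app k ((x₀, y) : X × Y)).2) h
    exact hy

end VarietyAlg

/-! ### Fullness from a diagonalizing term -/

namespace DiagonalizingTerm

variable [L.IsAlgebraic] (D : DiagonalizingTerm L E)

theorem nonempty (D : DiagonalizingTerm L E) (A : VarietyAlg L E) : Nonempty A :=
  ⟨constVal A (D.e ⟨0, D.one_le_k⟩)⟩

/-- Every morphism of products under a product is a product of morphisms. -/
theorem exists_prodMap (D : DiagonalizingTerm L E) {X Y P Q P' Q' : VarietyAlg L E}
    {a : X ⟶ P} {b : Y ⟶ Q} {a' : X ⟶ P'}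
    {b' : Y ⟶ Q'} (k : prod P Q ⟶ prod P' Q') (hk : prodMap a b ≫ k = prodMap a' b') :
    ∃ (r : P ⟶ P') (s : Q ⟶ Q'), k = prodMap r s ∧ a ≫ r = a' ∧ b ≫ s = b' := by
  have := D.nonempty X
  have := D.nonempty Y
  have := D.nonempty P
  have := D.nonempty Q
  have hg : ∀ {P Q : VarietyAlg L E} (a : X ⟶ P) (b : Y ⟶ Q),
      prodMap (constHom P) (constHom Q) = prodMap (constHom X) (constHom Y) ≫ prodMap a b :=
    fun a b => hom_ext fun ω => Prod.ext (app_constVal a ω.1).symm (app_constVal b ω.2).symm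
  -- Because `k` lies under `X × Y`, it carries the parameters from `F(∅)²` in `P × Q` to those in
  -- `P' × Q'`, hence preserves the diagonal operation. So each component of `k` depends on only one
  -- variable.
  have hd : ∀ x y : prod P Q, app k ((x.1, y.2) : P × Q) =
      (((app k x).1, (app k y).2) : P' × Q') := by
    intro x y
    rw [← D.diag_prod x y, app_diag, hg a b, Category.assoc, hk, ← hg a' b', D.diag_prod]
  obtain ⟨r, hr⟩ := exists_prodFst_comp (k ≫ prodFst P' Q') fun x y y' => by
    have h := congrArg (app (prodFst P' Q')) (hd ((x, y') : P × Q) ((x, y) : P × Q))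
    exact h
  obtain ⟨s, hs⟩ := exists_prodSnd_comp (k ≫ prodSnd P' Q') fun x x' y => by
    have h := congrArg (app (prodSnd P' Q')) (hd ((x, y) : P × Q) ((x', y) : P × Q))
    exact h
  have hrs : k = prodMap r s := hom_ext fun x => Prod.ext (congrArg (fun k => app k x) hr)
    (congrArg (fun k => app k x) hs)
  have hab : prodMap (a ≫ r) (b ≫ s) = prodMap a' b' := by
    rw [← hk, hrs]
    rfl
  exact ⟨r, s, hrs, prodMap_injective hab⟩

/-! ### Rectangular bands and product decompositions -/

namespace IsRectangular

variable {D} {B : VarietyAlg L E}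

/-- The counit of `F(U(B))` and `g` together give a morphism from `F(U(B)) + F(∅)²` to `B` that hits
every element by a variable, so the law for free algebras transfers. -/
theorem diag_self (h : D.IsRectangular) (g : constSq E ⟶ B) (x : B) : D.diag g x x = x := by
  let q : coprod (free E B) (constSq E) ⟶ B := coprodDesc (freeLift id) g
  have := congrArg (app q) ((h B).1 (inlVal _ (freeVar E x)))
  rwa [delta_eq_diag, app_diag] at this

theorem diag_funMap (h : D.IsRectangular) (g : constSq E ⟶ B)
    {n : ℕ} (φ : L.Functions n) (x y : Fin n → B) :
    Structure.funMap φ (fun i => D.diag g (x i) (y i)) =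
      D.diag g (Structure.funMap φ x) (Structure.funMap φ y) := by
  let q : coprod (free E B) (constSq E) ⟶ B := coprodDesc (freeLift id) g
  have := congrArg (app q) ((h B).2 n (Term.func φ Term.var)
    (fun i => inlVal _ (freeVar E (x i))) (fun i => inlVal _ (freeVar E (y i))))
  simp only [delta_eq_diag, app_diag, app_realize] at this
  exact this

/-- Every element of `A + F(∅)²` is determined by its two components in `A`. -/
theorem delta_splitHom (h : D.IsRectangular) (A : VarietyAlg L E) (w : coprod A (constSq E)) :
    D.delta A (inlVal _ (app (splitHom A) w).1) (inlVal _ (app (splitHom A) w).2) = w := by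
  let i := inl A (constSq E)
  let p := splitHom A ≫ prodFst A A ≫ i
  let q := splitHom A ≫ prodSnd A A ≫ i
  -- Reassembling the two components is a homomorphism, so it need only be compared with the
  -- identity on the two summands.
  let k : coprod A (constSq E) ⟶ coprod A (constSq E) :=
    mkHom (fun w => D.diag (inr A (constSq E)) (app p w) (app q w)) fun φ x => by
      rw [app_funMap, app_funMap, h.diag_funMap]
  have hk : k = 𝟙 _ := by
    refine coprod_hom_ext (hom_ext fun a => ?_) (hom_ext fun ω => ?_)
    · exact h.diag_self _ _
    -- A constant has the same value from either summand, so `(ω, ω')` is sent to `δ((ω, ω), (ω',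
    -- ω'))`, which `diag_prod` evaluates inside `F(∅)²` as `(ω, ω')`.
    · have hc : ∀ c : const E, inlVal (constSq E) (constVal A c) =
          inrVal A (B := constSq E) ((c, c) : const E × const E) := by
        intro c
        have h1 := app_constVal (inl A (constSq E)) c
        have h2 := app_constVal (inr A (constSq E)) c
        rw [constVal_prod, constVal_const] at h2
        exact h1.trans h2.symm
      have hid : 𝟙 (constSq E) = prodMap (constHom (const E)) (constHom (const E)) :=
        hom_ext fun x => Prod.ext (constVal_const x.1).symm (constVal_const x.2).symm
      have hω := congrArg (app (inr A (constSq E))) (D.diag_prod (P := const E) (Q := const E)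
        ((ω.1, ω.1) : const E × const E) ((ω.2, ω.2) : const E × const E))
      have hd := D.app_diag (prodMap (constHom (const E)) (constHom (const E)))
        (inr A (constSq E)) ((ω.1, ω.1) : const E × const E) ((ω.2, ω.2) : const E × const E)
      rw [← hid, Category.id_comp] at hd
      rw [← hid] at hω
      refine Eq.trans ?_ (hd.symm.trans hω)
      change D.diag _ (inlVal _ (constVal A ω.1)) (inlVal _ (constVal A ω.2)) = _
      rw [hc, hc]
      rfl
  exact congrArg (fun k => app k w) hk

theorem injective_splitHom (h : D.IsRectangular) (A : VarietyAlg L E) :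
    Function.Injective (app (splitHom A)) := by
  intro w w' hw
  rw [← h.delta_splitHom A w, hw, h.delta_splitHom]

/-- In `B × B` the law is evident; injectivity of `splitHom` lifts it to `B + F(∅)²`, and the
morphism given by the identity and `g` pushes it down to `B`. -/
theorem diag_diag_left (h : D.IsRectangular) (g : constSq E ⟶ B) (x y z : B) :
    D.diag g (D.diag g x y) z = D.diag g x z := by
  have := congrArg (app (coprodDesc (𝟙 B) g)) (h.injective_splitHom B
    (a₁ := D.delta B (D.delta B (inlVal _ x) (inlVal _ y)) (inlVal _ z))
    (a₂ := D.delta B (inlVal _ x) (inlVal _ z)) (by simp only [D.splitHom_delta]; rfl))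
  simp only [delta_eq_diag, app_diag] at this
  exact this

theorem diag_diag_right (h : D.IsRectangular) (g : constSq E ⟶ B) (x y z : B) :
    D.diag g x (D.diag g y z) = D.diag g x z := by
  have := congrArg (app (coprodDesc (𝟙 B) g)) (h.injective_splitHom B
    (a₁ := D.delta B (inlVal _ x) (D.delta B (inlVal _ y) (inlVal _ z)))
    (a₂ := D.delta B (inlVal _ x) (inlVal _ z)) (by simp only [D.splitHom_delta]; rfl))
  simp only [delta_eq_diag, app_diag] at this
  exact this

/-- The congruence of having the same first component. -/
@[reducible] def leftSetoid (h : D.IsRectangular) (g : constSq E ⟶ B) :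
    Setoid B where
  r x y := D.diag g x y = y
  iseqv := ⟨h.diag_self g, fun {x y} hxy => by rw [← hxy, h.diag_diag_left, h.diag_self],
    fun {x y z} hxy hyz => by rw [← hyz, ← hxy, h.diag_diag_left, h.diag_diag_right]⟩

/-- The congruence of having the same second component. -/
@[reducible] def rightSetoid (h : D.IsRectangular) (g : constSq E ⟶ B) :
    Setoid B where
  r x y := D.diag g x y = x
  iseqv := ⟨h.diag_self g, fun {x y} hxy => by rw [← hxy, h.diag_diag_right, h.diag_self],
    fun {x y z} hxy hyz => by rw [← hxy, ← hyz, h.diag_diag_left, h.diag_diag_right]⟩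

/-- Every morphism out of a product is isomorphic to a product of morphisms. -/
theorem exists_prod_decomposition (h : D.IsRectangular) {X Y : VarietyAlg L E}
    (f : prod X Y ⟶ B) :
    ∃ (P Q : VarietyAlg L E) (p : X ⟶ P) (q : Y ⟶ Q) (ψ : B ⟶ prod P Q),
      Function.Bijective (app ψ) ∧ f ≫ ψ = prodMap p q := by
  have := D.nonempty X
  have := D.nonempty Y
  let g : constSq E ⟶ B := prodMap (constHom X) (constHom Y) ≫ f
  -- Hence `f(x, y)` and `f(x, y')` have the same first component, and dually, so `f` induces
  -- morphisms on the two quotients.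
  have hf : ∀ x y : prod X Y, D.diag g (app f x) (app f y) = app f ((x.1, y.2) : X × Y) := by
    intro x y
    rw [← D.diag_prod x y, app_diag]
  have hl : ∀ {n : ℕ} (φ : L.Functions n) (x y : Fin n → B),
      (∀ i, h.leftSetoid g (x i) (y i)) →
        h.leftSetoid g (Structure.funMap φ x) (Structure.funMap φ y) := fun φ x y hxy =>
    (h.diag_funMap g φ x y).symm.trans (congrArg _ (funext hxy))
  have hr : ∀ {n : ℕ} (φ : L.Functions n) (x y : Fin n → B),
      (∀ i, h.rightSetoid g (x i) (y i)) →
        h.rightSetoid g (Structure.funMap φ x) (Structure.funMap φ y) := fun φ x y hxy =>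
    (h.diag_funMap g φ x y).symm.trans (congrArg _ (funext hxy))
  obtain ⟨p, hp⟩ := exists_prodFst_comp (f ≫ quotientMk hl) fun x y y' =>
    Quotient.sound (s := h.leftSetoid g) (hf ((x, y) : X × Y) ((x, y') : X × Y))
  obtain ⟨q, hq⟩ := exists_prodSnd_comp (f ≫ quotientMk hr) fun x x' y =>
    Quotient.sound (s := h.rightSetoid g) (hf ((x, y) : X × Y) ((x', y) : X × Y))
  refine ⟨_, _, p, q, prodLift (quotientMk hl) (quotientMk hr), ⟨fun x y hxy => ?_, fun z => ?_⟩,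
    hom_ext fun x => Prod.ext (congrArg (fun k => app k x) hp) (congrArg (fun k => app k x) hq)⟩
  · have h1 : D.diag g x y = y := Quotient.exact (s := h.leftSetoid g) (congrArg Prod.fst hxy)
    have h2 : D.diag g x y = x := Quotient.exact (s := h.rightSetoid g) (congrArg Prod.snd hxy)
    exact h2.symm.trans h1
  · obtain ⟨z₁, z₂⟩ := z
    obtain ⟨x, rfl⟩ := Quotient.exists_rep z₁
    obtain ⟨y, rfl⟩ := Quotient.exists_rep z₂
    -- This element has the first component of `x` and the second component of `y`.
    refine ⟨D.diag g x y, Prod.ext ?_ ?_⟩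
    · refine Quotient.sound (s := h.leftSetoid g) ?_
      change D.diag g (D.diag g x y) x = x
      rw [h.diag_diag_left, h.diag_self]
    · refine Quotient.sound (s := h.rightSetoid g) ?_
      change D.diag g (D.diag g x y) y = D.diag g x y
      rw [h.diag_diag_left]

theorem isCoextensive (h : D.IsRectangular) : IsCoextensive (VarietyAlg L E) := by
  have hfin := hasFiniteProducts (L := L) (E := E)
  refine ⟨hfin, fun X Y => { faithful := ⟨?_⟩, full := ⟨?_⟩, essSurj := ⟨?_⟩ }⟩
  · intro P Q φ φ' hφ
    have := D.nonempty P.1.right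
    have := D.nonempty P.2.right
    have hmap : Limits.prod.map φ.1.right φ.2.right = Limits.prod.map φ'.1.right φ'.2.right :=
      congrArg CommaMorphism.right hφ
    have hprod : prodMap φ.1.right φ.2.right = prodMap φ'.1.right φ'.2.right := by
      rw [← cancel_epi (prodIso P.1.right P.2.right).hom, ← prodMap_prodIso, hmap,
        prodMap_prodIso]
    obtain ⟨h1, h2⟩ := prodMap_injective hprod
    exact Prod.ext (Under.UnderMorphism.ext h1) (Under.UnderMorphism.ext h2)
  · intro P Q k
    let e := prodIso P.1.right P.2.right
    let e' := prodIso Q.1.right Q.2.right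
    let k' : Limits.prod P.1.right P.2.right ⟶ Limits.prod Q.1.right Q.2.right := k.right
    have hk : Limits.prod.map P.1.hom P.2.hom ≫ k' = Limits.prod.map Q.1.hom Q.2.hom :=
      Under.w k
    obtain ⟨r, s, hrs, hr, hs⟩ := D.exists_prodMap (a := P.1.hom) (b := P.2.hom)
      (a' := Q.1.hom) (b' := Q.2.hom) (e.inv ≫ k' ≫ e'.hom) (by
        rw [← cancel_epi (prodIso X Y).hom, ← prodMap_prodIso, ← hk, ← Category.assoc,
          ← prodMap_prodIso]
        simp only [e, e', Category.assoc, Iso.hom_inv_id_assoc])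
    refine ⟨(Under.homMk r hr, Under.homMk s hs), Under.UnderMorphism.ext ?_⟩
    change Limits.prod.map r s = k'
    rw [← cancel_mono e'.hom, prodMap_prodIso, ← hrs, Iso.hom_inv_id_assoc]
  · intro B
    obtain ⟨P, Q, p, q, ψ, hψ, hf⟩ := h.exists_prod_decomposition ((prodIso X Y).inv ≫ B.hom)
    have := isIso_of_bijective ψ hψ
    refine ⟨(Under.mk p, Under.mk q), ⟨(Under.isoMk (asIso ψ ≪≫ (prodIso P Q).symm) ?_).symm⟩⟩
    change B.hom ≫ ψ ≫ (prodIso P Q).inv = Limits.prod.map p q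
    rw [← Category.assoc, Iso.comp_inv_eq, prodMap_prodIso, ← hf]
    simp

end IsRectangular

end DiagonalizingTerm

end

theorem proposition4 (L : FirstOrder.Language.{u, v}) [L.IsAlgebraic]
    (E : Set (L.Term ℕ × L.Term ℕ)) :
    List.TFAE
      [ IsCoextensive (VarietyAlg L E),
        Nonempty (DiagonalizingTerm L E) ∧
          ∀ (A : VarietyAlg L E) (m n : ℕ) (u v : L.Term (Fin m ⊕ Fin n))
            (a : Fin m → A) (ω ω' : Fin n → VarietyAlg.const E),
            u.realize (Sum.elim (fun i => VarietyAlg.freeVar E (a i))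
                fun j => VarietyAlg.constVal (VarietyAlg.free E A) (ω j)) =
              v.realize (Sum.elim (fun i => VarietyAlg.freeVar E (a i))
                fun j => VarietyAlg.constVal (VarietyAlg.free E A) (ω j)) →
            u.realize (Sum.elim (fun i => VarietyAlg.freeVar E (a i))
                fun j => VarietyAlg.constVal (VarietyAlg.free E A) (ω' j)) =
              v.realize (Sum.elim (fun i => VarietyAlg.freeVar E (a i))
                fun j => VarietyAlg.constVal (VarietyAlg.free E A) (ω' j)) →
            u.realize (Sum.elim
                (fun i => VarietyAlg.inlVal _ (VarietyAlg.freeVar E (a i)))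
                fun j => VarietyAlg.pairVal (VarietyAlg.free E A) (ω j) (ω' j)) =
              v.realize (Sum.elim
                (fun i => VarietyAlg.inlVal _ (VarietyAlg.freeVar E (a i)))
                fun j => VarietyAlg.pairVal (VarietyAlg.free E A) (ω j) (ω' j)),
        ∃ D : DiagonalizingTerm L E, ∀ X : Type u,
          (∀ x, D.delta (VarietyAlg.free E X) x x = x) ∧
          ∀ (n : ℕ) (u : L.Term (Fin n))
            (x y : Fin n → VarietyAlg.coprod (VarietyAlg.free E X)
              (VarietyAlg.prod (VarietyAlg.const E) (VarietyAlg.const E))),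
            u.realize (fun i => D.delta (VarietyAlg.free E X) (x i) (y i)) =
              D.delta (VarietyAlg.free E X) (u.realize x) (u.realize y) ] := by
  tfae_have 1 → 2 := fun h => ⟨h.nonempty_diagonalizingTerm,
    PairedEquations.of_injective fun A => (h.bijective_splitHom A).1⟩
  tfae_have 2 → 3 := fun h =>
    h.1.elim fun D => ⟨D, PairedEquations.isRectangular h.2 D⟩
  tfae_have 3 → 1 := fun ⟨D, h⟩ => DiagonalizingTerm.IsRectangular.isCoextensive (D := D) h
  tfae_finish
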